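/- Let $A\in\mathbb{R}^{n\times n}$, $B\in\mathbb{R}^{n\times m}$, $C\in\mathbb{R}^{n\times p}$, and let $\mathcal{U}\subseteq\mathbb{R}^m$ and $\mathcal{W}\subseteq\mathbb{R}^p$ be hyperrectangles (nonempty products of compact intervals). Consider the linear system $$\dot x(t)=Ax(t)+Bu(t)+Cw(t),\qquad x(0)=x_0\in\mathbb{R}^n,$$ with controlled inputs $u(t)\in\mathcal{U}$ and undesirable inputs $w(t)\in\mathcal{W}$, and let $$\mathcal{Z}:=\{z\in B\mathcal{U}:\ z-Cw\in B\mathcal{U}\ \text{for all}\ w\in\mathcal{W}\}$$ be the Pontryagin difference of $B\mathcal{U}$ and $-C\mathcal{W}$. Suppose that $0\in\operatorname{int}(\mathcal{Z})$ (interior in $\mathbb{R}^n$) and that every complex eigenvalue $\lambda$ of $A$ satisfies $\operatorname{Re}\lambda\le 0$. Then the system is resiliently stabilizable: for every $x_0\in\mathbb{R}^n$ and every piecewise continuous $w:[0,\infty)\to\mathcal{W}$ there exist $T>0$ and a piecewise continuous $u:[0,\infty)\to\mathcal{U}$ such that the solution $x$ of the system on $[0,\infty)$ exists, is unique, and satisfies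 $x(T)=0$. Here piecewise continuous means having finitely many discontinuities on every bounded interval and finite one-sided limits at each of them, and a solution is a continuous $x:[0,\infty)\to\mathbb{R}^n$ with $x(0)=x_0$ that satisfies the differential equation at every $t>0$ at which $u$ and $w$ are continuous. -/

import Mathlib

open Set Filter Topology

namespace ResilientControl

/-- A (compact) hyperrectangle: a nonempty product of closed bounded intervals `[a i, b i]`. -/
def IsHyperrectangle {k : ℕ} (X : Set (Fin k → ℝ)) : Prop :=
  ∃ a b : Fin k → ℝ, (∀ i, a i ≤ b i) ∧ X = {x | ∀ i, a i ≤ x i ∧ x i ≤ b i}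

/-- The image `M X = {M x : x ∈ X}` of a set of vectors under a matrix. -/
def matImage {n k : ℕ} (M : Matrix (Fin n) (Fin k) ℝ) (X : Set (Fin k → ℝ)) :
    Set (Fin n → ℝ) :=
  {y | ∃ x ∈ X, y = M.mulVec x}

/-- The Pontryagin difference `{z ∈ X : z + y ∈ X for all y ∈ Y}`. -/
def pontryaginDiff {n : ℕ} (X Y : Set (Fin n → ℝ)) : Set (Fin n → ℝ) :=
  {z | z ∈ X ∧ ∀ y ∈ Y, z + y ∈ X}

/-- The set `𝒵`, the Pontryagin difference of `B 𝒰` and `-C 𝒲`. -/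
def dualInputSet {n m p : ℕ} (B : Matrix (Fin n) (Fin m) ℝ) (C : Matrix (Fin n) (Fin p) ℝ)
    (U : Set (Fin m → ℝ)) (W : Set (Fin p → ℝ)) : Set (Fin n → ℝ) :=
  pontryaginDiff (matImage B U) {y | ∃ c ∈ matImage C W, y = -c}

/-- The set of (complex) eigenvalues of a real square matrix. -/
def eigenvalueSet {n : ℕ} (A : Matrix (Fin n) (Fin n) ℝ) : Set ℂ :=
  {μ | Module.End.HasEigenvalue (Matrix.toLin' (A.map (fun r : ℝ => (r : ℂ)))) μ}

/-- Piecewise continuity of a signal on `[0, ∞)`: finitely many discontinuities on every bounded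
interval, and finite one-sided limits everywhere. Values at negative times play no role. -/
def PiecewiseContinuous {k : ℕ} (f : ℝ → Fin k → ℝ) : Prop :=
  (∀ T : ℝ, 0 < T → ∃ S : Set ℝ, S.Finite ∧ ContinuousOn f (Icc 0 T \ S)) ∧
  (∀ t : ℝ, 0 ≤ t → ∃ l, Tendsto f (𝓝[>] t) (𝓝 l)) ∧
  (∀ t : ℝ, 0 < t → ∃ l, Tendsto f (𝓝[<] t) (𝓝 l))

/-- A piecewise continuous signal `[0, ∞) → X`. -/
def IsSignal {k : ℕ} (X : Set (Fin k → ℝ)) (f : ℝ → Fin k → ℝ) : Prop :=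
  PiecewiseContinuous f ∧ ∀ t : ℝ, 0 ≤ t → f t ∈ X

/-- `x` solves `x' = A x + B u + C w`, `x 0 = x₀` on `[0, ∞)`: it is continuous and satisfies the
differential equation at every time `t > 0` at which the inputs `u` and `w` are continuous
(all but finitely many times of each bounded interval, for piecewise continuous inputs). -/
def IsSolution {n m p : ℕ} (A : Matrix (Fin n) (Fin n) ℝ) (B : Matrix (Fin n) (Fin m) ℝ)
    (C : Matrix (Fin n) (Fin p) ℝ) (u : ℝ → Fin m → ℝ) (w : ℝ → Fin p → ℝ) (x₀ : Fin n → ℝ)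
    (x : ℝ → Fin n → ℝ) : Prop :=
  ContinuousOn x (Ici 0) ∧ x 0 = x₀ ∧
    ∀ t : ℝ, 0 < t → ContinuousAt u t → ContinuousAt w t →
      HasDerivAt x (A.mulVec (x t) + B.mulVec (u t) + C.mulVec (w t)) t

/-- Resilient stabilizability of `x' = A x + B u + C w` with `u ∈ U` (controlled) and `w ∈ W`
(undesirable): from every initial state and for every undesirable signal there are a time `T > 0`
and a control signal such that the solution exists, is unique on `[0, ∞)`, and vanishes at `T`. -/
def ResilientlyStabilizable {n m p : ℕ} (A : Matrix (Fin n) (Fin n) ℝ)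
    (B : Matrix (Fin n) (Fin m) ℝ) (C : Matrix (Fin n) (Fin p) ℝ)
    (U : Set (Fin m → ℝ)) (W : Set (Fin p → ℝ)) : Prop :=
  ∀ (x₀ : Fin n → ℝ) (w : ℝ → Fin p → ℝ), IsSignal W w →
    ∃ T : ℝ, 0 < T ∧ ∃ u : ℝ → Fin m → ℝ, IsSignal U u ∧
      ∃ x : ℝ → Fin n → ℝ, IsSolution A B C u w x₀ x ∧
        (∀ y : ℝ → Fin n → ℝ, IsSolution A B C u w x₀ y → EqOn y x (Ici 0)) ∧
        x T = 0

end ResilientControl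

/-! Since `0` is interior to `𝒵`, there is a ball such that every net input `z` in it equals `B u +
C w` for each `w ∈ W` and a suitable `u ∈ U`. By `exists_continuous_feedback`, `u` can be chosen
continuous in `(w, z)`, so piecewise continuity passes from `w` to `u`. It remains to drive `x' = A
x + z` to the origin with continuous `z` in that ball, independently of `w`.

For this, complexify and split the state into generalized eigenvectors. If `(A - μ)^k` sends `v` to
an eigenvector, a long, flat bump times `-e^{tμ} v` removes the top component of `v`. The input
stays small because `Re μ ≤ 0`. What remains is killed by `(A - μ)^k`, and induction on `k` finishes
(`nullSteerable_of_generalized_eigenvector`). Contributions add up by linearity, and real parts give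
the real system. -/

namespace ResilientControl

/-! ### Continuous selection of preimages over a box. -/

section Selection

variable {ι : Type*} [Fintype ι] [DecidableEq ι]

/-- The weight of the vertex `{i | i ∈ s}` of the unit cube in the multilinear interpolation
at the point `θ`. -/
noncomputable def cubeWeight (θ : ι → ℝ) (s : Finset ι) : ℝ :=
  (∏ i ∈ s, θ i) * ∏ i ∈ sᶜ, (1 - θ i)

lemma sum_cubeWeight (θ : ι → ℝ) : ∑ s, cubeWeight θ s = 1 := by
  simp only [cubeWeight]
  rw [← Fintype.prod_add]
  simp

lemma cubeWeight_nonneg {θ : ι → ℝ} (h0 : ∀ i, 0 ≤ θ i) (h1 : ∀ i, θ i ≤ 1) (s : Finset ι) :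
    0 ≤ cubeWeight θ s :=
  mul_nonneg (Finset.prod_nonneg fun i _ => h0 i)
    (Finset.prod_nonneg fun i _ => sub_nonneg.2 (h1 i))

lemma continuous_cubeWeight (s : Finset ι) : Continuous fun θ : ι → ℝ => cubeWeight θ s := by
  unfold cubeWeight
  fun_prop

/-- Expand `∏ j, (θ j + (1 - θ j))` with the summand `1 - θ i` replaced by `0`: only the subsets
containing `i` survive, and the product is `θ i`. -/
lemma sum_cubeWeight_mem (θ : ι → ℝ) (i : ι) :
    ∑ s, (if i ∈ s then cubeWeight θ s else 0) = θ i := by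
  have h := Fintype.prod_add θ (fun j => if j = i then 0 else 1 - θ j)
  have h1 : ∏ j, (θ j + if j = i then 0 else 1 - θ j) = θ i := by
    rw [Finset.prod_eq_single i]
    · simp
    · intro j _ hj
      simp [hj]
    · simp
  rw [← h1, h]
  refine Finset.sum_congr rfl fun s _ => ?_
  split_ifs with hs
  · unfold cubeWeight
    congr 1
    refine Finset.prod_congr rfl fun j hj => ?_
    rw [if_neg]
    rintro rfl
    exact (Finset.mem_compl.1 hj) hs
  · rw [Finset.prod_eq_zero (s := sᶜ) (Finset.mem_compl.2 hs) (by simp), mul_zero]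

/-- If a linear map `M` maps a convex set `K` onto a set containing the image of a box under a
linear map `L`, then preimages can be chosen continuously over the box. -/
lemma exists_continuous_selection {F G : Type*} [AddCommGroup F] [Module ℝ F] [AddCommGroup G]
    [Module ℝ G] [TopologicalSpace G] [ContinuousAdd G] [ContinuousSMul ℝ G]
    (a b : ι → ℝ) (hab : a ≤ b) (L : (ι → ℝ) →ₗ[ℝ] F) (M : G →ₗ[ℝ] F) {K : Set G}
    (hK : Convex ℝ K) (h : ∀ y ∈ Icc a b, ∃ u ∈ K, M u = L y) :
    ∃ g : (ι → ℝ) → G, Continuous g ∧ ∀ y ∈ Icc a b, g y ∈ K ∧ M (g y) = L y := by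
  have hv : ∀ s : Finset ι, (fun i => if i ∈ s then b i else a i) ∈ Icc a b := by
    refine fun s => ⟨fun i => ?_, fun i => ?_⟩ <;> dsimp only <;> split_ifs <;>
      first | exact hab i | exact le_rfl
  choose v hvK hvM using fun s => h _ (hv s)
  -- On a degenerate edge `a i = b i`, division by zero gives `θ i = 0`, which is harmless since
  -- then `y i = a i`.
  let θ : (ι → ℝ) → ι → ℝ := fun y i => (y i - a i) / (b i - a i)
  have hθ : Continuous θ := by
    refine continuous_pi fun i => ?_
    exact ((continuous_apply i).sub continuous_const).div_const _
  refine ⟨fun y => ∑ s, cubeWeight (θ y) s • v s, ?_, fun y hy => ⟨?_, ?_⟩⟩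
  · exact continuous_finsetSum _ fun s _ =>
      ((continuous_cubeWeight s).comp hθ).smul continuous_const
  · refine hK.sum_mem (fun s _ => cubeWeight_nonneg (fun i => ?_) (fun i => ?_) s)
      (sum_cubeWeight _) fun s _ => hvK s
    · exact div_nonneg (sub_nonneg.2 (hy.1 i)) (sub_nonneg.2 (hab i))
    · exact div_le_one_of_le₀ (sub_le_sub_right (hy.2 i) _) (sub_nonneg.2 (hab i))
  -- By linearity it suffices that the multilinear weights average the vertices of the box to `y`.
  · simp only [map_sum, map_smul, hvM]
    simp only [← map_smul, ← map_sum]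
    congr 1
    ext i
    have key : ∀ s, cubeWeight (θ y) s * (if i ∈ s then b i else a i) =
        cubeWeight (θ y) s * a i + (if i ∈ s then cubeWeight (θ y) s else 0) * (b i - a i) := by
      intro s
      split_ifs <;> ring
    simp only [Finset.sum_apply, Pi.smul_apply, smul_eq_mul, key, Finset.sum_add_distrib]
    rw [← Finset.sum_mul, ← Finset.sum_mul, sum_cubeWeight, sum_cubeWeight_mem]
    rcases (hab i).eq_or_lt with he | hlt
    · have h1 := hy.1 i
      have h2 := hy.2 i
      rw [← he] at h2 ⊢
      linarith
    · have : b i - a i ≠ 0 := (sub_pos.2 hlt).ne'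
      simp only [θ]
      field_simp
      ring

end Selection

/-! ### The flow `e^{tA}` and variation of constants. -/

section Flow

variable {E : Type*} [NormedAddCommGroup E] [NormedSpace ℝ E]

/-- The flow `e^{tA}` of the linear differential equation `x' = A x`. -/
noncomputable def flow (A : E →L[ℝ] E) (t : ℝ) : E →L[ℝ] E := NormedSpace.exp (t • A)

@[simp] lemma flow_zero (A : E →L[ℝ] E) : flow A 0 = 1 := by simp [flow]

lemma commute_flow {A P : E →L[ℝ] E} (h : Commute P A) (t : ℝ) : Commute P (flow A t) :=
  (h.smul_right t).exp_right

variable [CompleteSpace E]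

lemma flow_add (A : E →L[ℝ] E) (s t : ℝ) : flow A (s + t) = flow A s * flow A t := by
  let _ : NormedAlgebra ℚ (E →L[ℝ] E) := NormedAlgebra.restrictScalars ℚ ℝ _
  rw [flow, add_smul]
  exact NormedSpace.exp_add_of_commute (((Commute.refl A).smul_left s).smul_right t)

lemma flow_add_apply (A : E →L[ℝ] E) (s t : ℝ) (x : E) :
    flow A (s + t) x = flow A s (flow A t x) := by
  rw [flow_add]; rfl

@[simp] lemma flow_flow_neg (A : E →L[ℝ] E) (t : ℝ) (x : E) : flow A t (flow A (-t) x) = x := by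
  rw [← flow_add_apply]; simp

@[simp] lemma flow_neg_flow (A : E →L[ℝ] E) (t : ℝ) (x : E) : flow A (-t) (flow A t x) = x := by
  rw [← flow_add_apply]; simp

lemma hasDerivAt_flow (A : E →L[ℝ] E) (t : ℝ) : HasDerivAt (flow A) (A * flow A t) t :=
  hasDerivAt_exp_smul_const' A t

lemma flow_comm (A : E →L[ℝ] E) (t : ℝ) : flow A t * A = A * flow A t :=
  (hasDerivAt_exp_smul_const A t).unique (hasDerivAt_exp_smul_const' A t)

@[fun_prop] lemma continuous_flow (A : E →L[ℝ] E) : Continuous (flow A) :=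
  continuous_iff_continuousAt.2 fun t => (hasDerivAt_flow A t).continuousAt

lemma hasDerivAt_flow_apply (A : E →L[ℝ] E) {f : ℝ → E} {f' : E} {t : ℝ}
    (hf : HasDerivAt f f' t) :
    HasDerivAt (fun s => flow A s (f s)) (A (flow A t (f t)) + flow A t f') t :=
  (hasDerivAt_flow A t).clm_apply hf

lemma hasDerivAt_flow_neg_apply (A : E →L[ℝ] E) {f : ℝ → E} {f' : E} {t : ℝ}
    (hf : HasDerivAt f f' t) :
    HasDerivAt (fun s => flow A (-s) (f s)) (flow A (-t) (f' - A (f t))) t := by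
  have h := ((hasDerivAt_flow A (-t)).scomp t (hasDerivAt_neg t)).clm_apply hf
  rw [← flow_comm] at h
  simpa [sub_eq_neg_add, Function.comp_def] using h

/-- A solution of `d' = A d` outside a finite set vanishes if its initial value does. -/
lemma eq_zero_of_hasDerivAt_off_finite (A : E →L[ℝ] E) {d : ℝ → E} {T : ℝ} (hT : 0 ≤ T)
    {S : Set ℝ} (hS : S.Finite) (hc : ContinuousOn d (Icc 0 T)) (h0 : d 0 = 0)
    (hd : ∀ t ∈ Ioo 0 T \ S, HasDerivAt d (A (d t)) t) : d T = 0 := by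
  -- `e^{-sA} d(s)` is continuous with zero derivative off `S`, hence has equal values at `0` and
  -- `T`.
  have h := MeasureTheory.integral_eq_of_hasDerivAt_off_countable_of_le
    (fun s => flow A (-s) (d s)) (fun _ => 0) hT hS.countable
    (((continuous_flow A).comp continuous_neg).continuousOn.clm_apply hc)
    (fun t ht => by simpa using hasDerivAt_flow_neg_apply A (hd t ht)) (by simp)
  have h2 : flow A (-T) (d T) = 0 := by simpa [h0] using h.symm
  rw [← flow_flow_neg A T (d T), h2, map_zero]

/-- The variation of constants formula. -/
lemma hasDerivAt_variation_of_constants (A : E →L[ℝ] E) (x₀ : E) {z : ℝ → E} (hz : Continuous z)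
    (t : ℝ) :
    HasDerivAt (fun t => flow A t (x₀ + ∫ s in (0 : ℝ)..t, flow A (-s) (z s)))
      (A (flow A t (x₀ + ∫ s in (0 : ℝ)..t, flow A (-s) (z s))) + z t) t := by
  have hc : Continuous fun s => flow A (-s) (z s) := by fun_prop
  simpa using hasDerivAt_flow_apply A ((hc.integral_hasStrictDerivAt 0 t).hasDerivAt.const_add x₀)

/-- The curve `e^{-tA} (e^{tμ} v)` has zero derivative. The flow is defined over `ℝ`, so complex
homogeneity of `A` is a separate hypothesis. -/
lemma flow_apply_of_eigenvector {E : Type*} [NormedAddCommGroup E] [NormedSpace ℂ E]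
    [CompleteSpace E] (A : E →L[ℝ] E) {μ : ℂ} {v : E} (hv : A v = μ • v)
    (hA : ∀ (c : ℂ) x, A (c • x) = c • A x) (t : ℝ) :
    flow A t v = Complex.exp (t * μ) • v := by
  have hd : ∀ t : ℝ, HasDerivAt (fun t : ℝ => flow A (-t) (Complex.exp (t * μ) • v)) 0 t := by
    intro t
    have he : HasDerivAt (fun t : ℝ => Complex.exp (t * μ) • v)
        ((Complex.exp (t * μ) * μ) • v) t := by
      have := ((hasDerivAt_id (t : ℂ)).mul_const μ).cexp.comp_ofReal
      simpa using this.smul_const v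
    convert hasDerivAt_flow_neg_apply A he using 1
    rw [hA, hv, smul_smul, sub_self, map_zero]
  have h := is_const_of_deriv_eq_zero (fun t => (hd t).differentiableAt) (fun t => (hd t).deriv) t 0
  have h2 : flow A (-t) (Complex.exp (t * μ) • v) = v := by simpa using h
  rw [← flow_flow_neg A t (Complex.exp (t * μ) • v), h2]

end Flow

end ResilientControl

namespace ResilientControl

/-! ### Steering to the origin: superposition, concatenation, flat bumps. -/

section Steering

variable {E : Type*} [NormedAddCommGroup E] [NormedSpace ℝ E]

/-- The state `x` can be driven to the origin in finite time along `x' = A x + z` by a continuous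
input `z` of norm at most `δ`. -/
def NullSteerable (A : E →L[ℝ] E) (δ : ℝ) (x : E) : Prop :=
  ∃ T : ℝ, 0 < T ∧ ∃ z : ℝ → E, Continuous z ∧ (∀ t ≤ 0, z t = 0) ∧ (∀ t, T ≤ t → z t = 0) ∧
    (∀ t, ‖z t‖ ≤ δ) ∧ ∫ s in (0 : ℝ)..T, flow A (-s) (z s) = -x

lemma nullSteerable_zero (A : E →L[ℝ] E) {δ : ℝ} (hδ : 0 ≤ δ) : NullSteerable A δ 0 :=
  ⟨1, one_pos, 0, continuous_const, by simp, by simp, by simpa using hδ, by simp⟩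

variable [CompleteSpace E]

lemma integral_flow_eq_of_le (A : E →L[ℝ] E) {z : ℝ → E} (hz : Continuous z) {T T' : ℝ}
    (h : T ≤ T') (h0 : ∀ t, T ≤ t → z t = 0) :
    ∫ s in (0 : ℝ)..T', flow A (-s) (z s) = ∫ s in (0 : ℝ)..T, flow A (-s) (z s) := by
  have hc : Continuous fun s => flow A (-s) (z s) := by fun_prop
  rw [← intervalIntegral.integral_add_adjacent_intervals (hc.intervalIntegrable 0 T)
    (hc.intervalIntegrable T T'), add_eq_left]
  refine (intervalIntegral.integral_congr (g := fun _ => 0) fun s hs => ?_).trans (by simp)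
  rw [uIcc_of_le h] at hs
  simp [h0 s hs.1]

lemma NullSteerable.add {A : E →L[ℝ] E} {δ ε : ℝ} {x y : E} (hx : NullSteerable A δ x)
    (hy : NullSteerable A ε y) : NullSteerable A (δ + ε) (x + y) := by
  obtain ⟨T, hT, z, hz, hz0, hzT, hzn, hzi⟩ := hx
  obtain ⟨T', hT', z', hz', hz0', hzT', hzn', hzi'⟩ := hy
  refine ⟨max T T', lt_max_of_lt_left hT, fun t => z t + z' t, hz.add hz', fun t ht => ?_,
    fun t ht => ?_, fun t => ?_, ?_⟩
  · simp [hz0 t ht, hz0' t ht]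
  · simp [hzT t (le_of_max_le_left ht), hzT' t (le_of_max_le_right ht)]
  · exact (norm_add_le _ _).trans (add_le_add (hzn t) (hzn' t))
  · have hc : Continuous fun s => flow A (-s) (z s) := by fun_prop
    have hc' : Continuous fun s => flow A (-s) (z' s) := by fun_prop
    simp only [map_add]
    rw [intervalIntegral.integral_add (hc.intervalIntegrable _ _) (hc'.intervalIntegrable _ _),
      integral_flow_eq_of_le A hz (le_max_left _ _) hzT,
      integral_flow_eq_of_le A hz' (le_max_right _ _) hzT', hzi, hzi', neg_add]

/-- Inputs can be concatenated: a state that can be driven to a steerable state is steerable. -/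
lemma NullSteerable.of_reach {A : E →L[ℝ] E} {δ T : ℝ} {x : E} (hT : 0 < T) {z : ℝ → E}
    (hz : Continuous z) (hz0 : ∀ t ≤ 0, z t = 0) (hzT : ∀ t, T ≤ t → z t = 0)
    (hzn : ∀ t, ‖z t‖ ≤ δ)
    (h : NullSteerable A δ (flow A T (x + ∫ s in (0 : ℝ)..T, flow A (-s) (z s)))) :
    NullSteerable A δ x := by
  obtain ⟨T', hT', z', hz', hz0', hzT', hzn', hzi'⟩ := h
  -- The second input is delayed by `T`. At each time at most one summand is nonzero, so the bound
  -- stays `δ`.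
  have hs : Continuous fun t => z' (t - T) := by fun_prop
  refine ⟨T + T', by positivity, fun t => z t + z' (t - T), hz.add hs, fun t ht => ?_,
    fun t ht => ?_, fun t => ?_, ?_⟩
  · simp [hz0 t ht, hz0' (t - T) (by linarith)]
  · simp [hzT t (by linarith), hzT' (t - T) (by linarith)]
  · rcases le_total t T with ht | ht
    · simpa [hz0' (t - T) (by linarith)] using hzn t
    · simpa [hzT t ht] using hzn' (t - T)
  · have hc : Continuous fun s => flow A (-s) (z s) := by fun_prop
    have hc' : Continuous fun s => flow A (-s) (z' (s - T)) := by fun_prop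
    have h1 : ∫ s in (0 : ℝ)..T, flow A (-s) (z' (s - T)) = 0 := by
      refine (intervalIntegral.integral_congr (g := fun _ => 0) fun s hs => ?_).trans (by simp)
      rw [uIcc_of_le hT.le] at hs
      simp [hz0' _ (sub_nonpos.2 hs.2)]
    have h2 : ∫ s in T..(T + T'), flow A (-s) (z' (s - T)) =
        flow A (-T) (∫ s in (0 : ℝ)..T', flow A (-s) (z' s)) := by
      have hc2 : Continuous fun s => flow A (-s) (z' s) := by fun_prop
      rw [← ContinuousLinearMap.intervalIntegral_comp_comm _ (hc2.intervalIntegrable _ _)]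
      simp only [← flow_add_apply]
      have := intervalIntegral.integral_comp_sub_right (a := T) (b := T + T')
        (fun s => flow A (-T + -s) (z' s)) T
      rw [sub_self, add_sub_cancel_left] at this
      rw [← this]
      refine intervalIntegral.integral_congr fun s _ => ?_
      congr 3
      ring
    simp only [map_add]
    rw [intervalIntegral.integral_add (hc.intervalIntegrable _ _) (hc'.intervalIntegrable _ _),
      integral_flow_eq_of_le A hz (by linarith) hzT,
      ← intervalIntegral.integral_add_adjacent_intervals (hc'.intervalIntegrable 0 T)
        (hc'.intervalIntegrable T (T + T')), h1, h2, hzi', map_neg, flow_neg_flow]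
    abel

/-- There are arbitrarily flat continuous bumps of integral one. -/
lemma exists_flat_bump {ε : ℝ} (hε : 0 < ε) : ∃ T : ℝ, 0 < T ∧ ∃ q : ℝ → ℝ, Continuous q ∧
    (∀ t ≤ 0, q t = 0) ∧ (∀ t, T ≤ t → q t = 0) ∧ (∀ t, 0 ≤ q t) ∧ (∀ t, q t ≤ ε) ∧
    ∫ t in (0 : ℝ)..T, q t = 1 := by
  -- The parabola `6 t (T - t) / T ^ 3` has integral `1` on `[0, T]` and peak `3 / (2 T)`, which is
  -- `3 ε / 4` for this `T`.
  have hT : 0 < 2 / ε := by positivity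
  set T := 2 / ε with hTdef
  have hεT : ε * T = 2 := by rw [hTdef]; field_simp
  refine ⟨T, hT, fun t => max 0 (6 / T ^ 3 * (t * (T - t))), by fun_prop, fun t ht => ?_,
    fun t ht => ?_, fun t => le_max_left _ _, fun t => max_le hε.le ?_, ?_⟩
  · exact max_eq_left (mul_nonpos_of_nonneg_of_nonpos (by positivity)
      (mul_nonpos_of_nonpos_of_nonneg ht (by linarith)))
  · exact max_eq_left (mul_nonpos_of_nonneg_of_nonpos (by positivity)
      (mul_nonpos_of_nonneg_of_nonpos (by linarith) (by linarith)))
  · have h1 : t * (T - t) ≤ T ^ 2 / 4 := by nlinarith [sq_nonneg (T - 2 * t)]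
    have h2 : 6 / T ^ 3 * (t * (T - t)) ≤ 6 / T ^ 3 * (T ^ 2 / 4) := by gcongr
    refine h2.trans ?_
    have h3 : 6 / T ^ 3 * (T ^ 2 / 4) = 3 / 2 / T := by field_simp; norm_num
    rw [h3, div_le_iff₀ hT]
    linarith
  · have h : ∫ t in (0 : ℝ)..T, max 0 (6 / T ^ 3 * (t * (T - t))) =
        ∫ t in (0 : ℝ)..T, 6 / T ^ 3 * (T * t - t ^ 2) := by
      refine intervalIntegral.integral_congr fun t ht => ?_
      rw [uIcc_of_le hT.le] at ht
      rw [max_eq_right (mul_nonneg (by positivity) (mul_nonneg ht.1 (by linarith [ht.2])))]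
      ring
    rw [h, intervalIntegral.integral_const_mul, intervalIntegral.integral_sub
      (Continuous.intervalIntegrable (by fun_prop) _ _)
      (Continuous.intervalIntegrable (by fun_prop) _ _),
      intervalIntegral.integral_const_mul, integral_id, integral_pow]
    field_simp
    norm_num
    ring

end Steering

/-! ### Null-steerability over `ℂ` from the spectral condition. -/

section Complex

variable {E : Type*} [NormedAddCommGroup E] [NormedSpace ℂ E] [CompleteSpace E]

/-- A generalized eigenvector for an eigenvalue of nonpositive real part is steerable. -/
lemma nullSteerable_of_generalized_eigenvector (f : E →L[ℂ] E) {μ : ℂ} (hμ : μ.re ≤ 0) {δ : ℝ}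
    (hδ : 0 < δ) (k : ℕ) (v : E) (hv : ((f - μ • 1) ^ k) v = 0) :
    NullSteerable (f.restrictScalars ℝ) δ v := by
  induction k generalizing v with
  | zero =>
    have : v = 0 := by simpa using hv
    rw [this]
    exact nullSteerable_zero _ hδ.le
  | succ k ih =>
    set A : E →L[ℝ] E := f.restrictScalars ℝ with hA
    set N : E →L[ℂ] E := f - μ • 1 with hN
    set P : E →L[ℝ] E := (N ^ k).restrictScalars ℝ with hP
    have hcomm : Commute P A := by
      have h1 : Commute N f := (Commute.refl f).sub_left ((Commute.one_left f).smul_left μ)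
      ext x
      exact congrArg (fun g : E →L[ℂ] E => g x) (h1.pow_left k).eq
    have hPf : ∀ t x, P (flow A t x) = flow A t (P x) := fun t x =>
      congrArg (fun g : E →L[ℝ] E => g x) (commute_flow hcomm t).eq
    have hAP : A (P v) = μ • P v := by
      have : N (P v) = 0 := by
        rw [pow_succ'] at hv
        exact hv
      exact sub_eq_zero.1 this
    obtain ⟨T, hT, q, hq, hq0, hqT, hqn, hqε, hqi⟩ :=
      exists_flat_bump (show 0 < δ / (‖v‖ + 1) by positivity)
    -- Using `e^{tμ} v` rather than `e^{tA} v` avoids polynomial growth. After applying `P` the two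
    -- agree, since `A (P v) = μ • P v`; so the input contributes `-P v` in total and the state
    -- reached lies in the kernel of `P`.
    set z : ℝ → E := fun t => -((q t : ℂ) • Complex.exp (t * μ) • v) with hzdef
    have hz : Continuous z := by fun_prop
    refine NullSteerable.of_reach hT hz (fun t ht => by simp [hzdef, hq0 t ht])
      (fun t ht => by simp [hzdef, hqT t ht]) (fun t => ?_) (ih _ ?_)
    · rcases le_total t 0 with ht | ht
      · simpa [hzdef, hq0 t ht] using hδ.le
      · have he : ‖Complex.exp (t * μ)‖ ≤ 1 := by
          rw [Complex.norm_exp, Real.exp_le_one_iff]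
          simpa using mul_nonpos_of_nonneg_of_nonpos ht hμ
        simp only [hzdef, norm_neg, norm_smul, Complex.norm_real, Real.norm_of_nonneg (hqn t)]
        calc q t * (‖Complex.exp (t * μ)‖ * ‖v‖)
            ≤ δ / (‖v‖ + 1) * (1 * (‖v‖ + 1)) := by
              gcongr
              · exact hqε t
              · linarith
          _ = δ := by field_simp
    · have hc : Continuous fun s => flow A (-s) (z s) := by fun_prop
      have hPz : ∀ s, P (flow A (-s) (z s)) = q s • (-P v) := by
        intro s
        have hPc : ∀ (c : ℂ) x, P (c • x) = c • P x := fun c x => (N ^ k).map_smul c x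
        have h1 : P (z s) = (-((q s : ℂ) * Complex.exp (s * μ))) • P v := by
          simp only [hzdef, map_neg, hPc, smul_smul, neg_smul]
        have h2 : A ((-((q s : ℂ) * Complex.exp (s * μ))) • P v) =
            μ • ((-((q s : ℂ) * Complex.exp (s * μ))) • P v) := by
          rw [smul_comm μ, ← hAP]
          exact f.map_smul _ _
        rw [hPf, h1, flow_apply_of_eigenvector A h2 (fun c x => f.map_smul c x), smul_smul,
          smul_neg, ← neg_smul, ← Complex.coe_smul]
        congr 1
        rw [mul_neg, mul_left_comm, ← Complex.exp_add]
        simp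
      change P _ = 0
      rw [hPf, map_add, ← ContinuousLinearMap.intervalIntegral_comp_comm _
        (hc.intervalIntegrable _ _)]
      simp only [hPz]
      rw [intervalIntegral.integral_smul_const, hqi]
      simp

/-- If all eigenvalues have nonpositive real part, then every state is steerable by arbitrarily
small inputs. -/
lemma nullSteerable_of_eigenvalues [FiniteDimensional ℂ E] (f : E →L[ℂ] E)
    (hf : ∀ μ, Module.End.HasEigenvalue (f : E →ₗ[ℂ] E) μ → μ.re ≤ 0) (x : E) :
    ∀ δ > 0, NullSteerable (f.restrictScalars ℝ) δ x := by
  have hx : x ∈ ⨆ μ, Module.End.maxGenEigenspace (f : E →ₗ[ℂ] E) μ := by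
    rw [Module.End.iSup_maxGenEigenspace_eq_top]; trivial
  induction hx using Submodule.iSup_induction' with
  | mem μ v hv =>
    intro δ hδ
    obtain ⟨k, hk⟩ := (Module.End.mem_maxGenEigenspace _ _ _).1 hv
    -- The supremum runs over all `μ : ℂ`; a nonzero `v` is what makes `μ` an eigenvalue.
    by_cases hv0 : v = 0
    · rw [hv0]
      exact nullSteerable_zero _ hδ.le
    · have hμ : Module.End.HasEigenvalue (f : E →ₗ[ℂ] E) μ := by
        refine Module.End.HasUnifEigenvalue.lt (k := ⊤) zero_lt_one ?_
        exact (Submodule.ne_bot_iff _).2 ⟨v, hv, hv0⟩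
      refine nullSteerable_of_generalized_eigenvector f (hf μ hμ) hδ k v ?_
      rw [← hk, ← ContinuousLinearMap.coe_coe, ContinuousLinearMap.toLinearMap_pow]
      rfl
  | zero => exact fun δ hδ => nullSteerable_zero _ hδ.le
  | add x y _ _ hx hy =>
    intro δ hδ
    rw [← add_halves δ]
    exact (hx _ (half_pos hδ)).add (hy _ (half_pos hδ))

end Complex

end ResilientControl

/-! ### Return to the real system: real parts, uniqueness, feedback. -/

namespace ResilientControl

/-- If all complex eigenvalues of `A` have nonpositive real part, then every state can be driven to
the origin along `x' = A x + z` by arbitrarily small continuous inputs `z`. -/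
lemma exists_solution_reaching_zero {n : ℕ} (A : Matrix (Fin n) (Fin n) ℝ)
    (hA : ∀ μ ∈ eigenvalueSet A, μ.re ≤ 0) (x₀ : Fin n → ℝ) {δ : ℝ} (hδ : 0 < δ) :
    ∃ T : ℝ, 0 < T ∧ ∃ z x : ℝ → Fin n → ℝ, Continuous z ∧ (∀ t, ‖z t‖ ≤ δ) ∧
      (∀ t, HasDerivAt x (A.mulVec (x t) + z t) t) ∧ x 0 = x₀ ∧ x T = 0 := by
  set A' := A.map (fun r : ℝ => (r : ℂ)) with hA'
  set f : (Fin n → ℂ) →L[ℂ] (Fin n → ℂ) := LinearMap.toContinuousLinearMap (Matrix.toLin' A')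
    with hf
  obtain ⟨T, hT, z, hz, -, -, hzn, hzi⟩ := nullSteerable_of_eigenvalues f
    (fun μ hμ => hA μ (by simpa [eigenvalueSet, hf] using hμ)) (fun i => (x₀ i : ℂ)) δ hδ
  have hx := hasDerivAt_variation_of_constants (f.restrictScalars ℝ) (fun i => (x₀ i : ℂ)) hz
  set x := fun t => flow (f.restrictScalars ℝ) t ((fun i => (x₀ i : ℂ)) +
    ∫ s in (0 : ℝ)..t, flow (f.restrictScalars ℝ) (-s) (z s)) with hxdef
  -- Taking real parts commutes with the real matrix `A` and does not increase the sup norm.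
  refine ⟨T, hT, fun t i => (z t i).re, fun t i => (x t i).re, by fun_prop, fun t => ?_,
    fun t => ?_, ?_, ?_⟩
  · refine (pi_norm_le_iff_of_nonneg hδ.le).2 fun i => ?_
    exact (Complex.abs_re_le_norm _).trans ((norm_le_pi_norm (z t) i).trans (hzn t))
  · refine hasDerivAt_pi.2 fun i => ?_
    have h1 := Complex.reCLM.hasFDerivAt.comp_hasDerivAt t (hasDerivAt_pi.1 (hx t) i)
    have h2 : ((A'.mulVec (x t)) i).re = A.mulVec (fun j => (x t j).re) i := by
      simp [Matrix.mulVec, dotProduct, hA']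
    refine h1.congr_deriv ?_
    rw [Pi.add_apply, map_add, Pi.add_apply, ← h2]
    rfl
  · ext i
    simp [hxdef]
  · ext i
    simp [hxdef, hzi]

/-- Piecewise continuity is preserved by continuous transformations with a continuous parameter. -/
lemma PiecewiseContinuous.comp_continuous {k l : ℕ} {w : ℝ → Fin k → ℝ}
    (hw : PiecewiseContinuous w) {F : Type*} [TopologicalSpace F] {z : ℝ → F} (hz : Continuous z)
    {g : (Fin k → ℝ) × F → Fin l → ℝ} (hg : Continuous g) :
    PiecewiseContinuous fun t => g (w t, z t) := by
  refine ⟨fun T hT => ?_, fun t ht => ?_, fun t ht => ?_⟩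
  · obtain ⟨S, hS, hc⟩ := hw.1 T hT
    exact ⟨S, hS, hg.comp_continuousOn (hc.prodMk hz.continuousOn)⟩
  · obtain ⟨l, hl⟩ := hw.2.1 t ht
    exact ⟨_, (hg.tendsto _).comp (hl.prodMk_nhds (hz.continuousAt.mono_left nhdsWithin_le_nhds))⟩
  · obtain ⟨l, hl⟩ := hw.2.2 t ht
    exact ⟨_, (hg.tendsto _).comp (hl.prodMk_nhds (hz.continuousAt.mono_left nhdsWithin_le_nhds))⟩

lemma PiecewiseContinuous.exists_continuousAt {k : ℕ} {f : ℝ → Fin k → ℝ}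
    (hf : PiecewiseContinuous f) {T : ℝ} (hT : 0 < T) :
    ∃ S : Set ℝ, S.Finite ∧ ∀ t ∈ Ioo 0 T \ S, ContinuousAt f t := by
  obtain ⟨S, hS, hc⟩ := hf.1 T hT
  refine ⟨S, hS, fun t ht => hc.continuousAt ?_⟩
  exact inter_mem (Icc_mem_nhds ht.1.1 ht.1.2) (hS.isClosed.isOpen_compl.mem_nhds ht.2)

/-- Solutions for piecewise continuous inputs are unique. -/
lemma IsSolution.eqOn {n m p : ℕ} {A : Matrix (Fin n) (Fin n) ℝ} {B : Matrix (Fin n) (Fin m) ℝ}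
    {C : Matrix (Fin n) (Fin p) ℝ} {u : ℝ → Fin m → ℝ} {w : ℝ → Fin p → ℝ} {x₀ : Fin n → ℝ}
    {x y : ℝ → Fin n → ℝ} (hu : PiecewiseContinuous u) (hw : PiecewiseContinuous w)
    (hy : IsSolution A B C u w x₀ y) (hx : IsSolution A B C u w x₀ x) : EqOn y x (Ici 0) := by
  intro T hT
  rcases eq_or_lt_of_le (mem_Ici.1 hT) with rfl | hT
  · rw [hy.2.1, hx.2.1]
  obtain ⟨S, hS, hSc⟩ := hu.exists_continuousAt hT
  obtain ⟨S', hS', hSc'⟩ := hw.exists_continuousAt hT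
  refine sub_eq_zero.1 (eq_zero_of_hasDerivAt_off_finite
    (LinearMap.toContinuousLinearMap (Matrix.toLin' A)) (d := fun t => y t - x t) hT.le
    (hS.union hS') ((hy.1.sub hx.1).mono Icc_subset_Ici_self) (by simp [hy.2.1, hx.2.1])
    fun t ht => ?_)
  have hut := hSc t ⟨ht.1, fun h => ht.2 (Or.inl h)⟩
  have hwt := hSc' t ⟨ht.1, fun h => ht.2 (Or.inr h)⟩
  refine ((hy.2.2 t ht.1.1 hut hwt).sub (hx.2.2 t ht.1.1 hut hwt)).congr_deriv ?_
  simp only [LinearMap.coe_toContinuousLinearMap', Matrix.toLin'_apply, Matrix.mulVec_sub]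
  abel

/-- Inputs `z` in a small ball can be realized as `B u + C w` with `u ∈ U` depending continuously
on `w ∈ W` and `z`. -/
lemma exists_continuous_feedback {n m p : ℕ} {B : Matrix (Fin n) (Fin m) ℝ}
    {C : Matrix (Fin n) (Fin p) ℝ} {U : Set (Fin m → ℝ)} {W : Set (Fin p → ℝ)}
    (hU : IsHyperrectangle U) (hW : IsHyperrectangle W)
    (hZ : (0 : Fin n → ℝ) ∈ interior (dualInputSet B C U W)) :
    ∃ δ : ℝ, 0 < δ ∧ ∃ g : (Fin p → ℝ) × (Fin n → ℝ) → Fin m → ℝ, Continuous g ∧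
      ∀ w ∈ W, ∀ z, ‖z‖ ≤ δ → g (w, z) ∈ U ∧ B.mulVec (g (w, z)) + C.mulVec w = z := by
  obtain ⟨δ, hδ, hball⟩ := Metric.nhds_basis_closedBall.mem_iff.1 (mem_interior_iff_mem_nhds.1 hZ)
  obtain ⟨a, b, hab, rfl⟩ := hW
  have hUc : Convex ℝ U := by
    obtain ⟨c, d, -, rfl⟩ := hU
    have : {x : Fin m → ℝ | ∀ i, c i ≤ x i ∧ x i ≤ d i} = Icc c d := by
      ext x
      simp [Pi.le_def, forall_and]
    rw [this]
    exact convex_Icc c d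
  -- `L (w, z) = z - C w`. In the sup norm the `δ`-ball is a box, so the pairs `(w, z)` range over a
  -- box and the selection lemma applies.
  let L : (Fin p ⊕ Fin n → ℝ) →ₗ[ℝ] (Fin n → ℝ) :=
    LinearMap.funLeft ℝ ℝ Sum.inr - Matrix.toLin' C ∘ₗ LinearMap.funLeft ℝ ℝ Sum.inl
  have hL : ∀ y, L y = y ∘ Sum.inr - C.mulVec (y ∘ Sum.inl) := fun y => rfl
  obtain ⟨g, hg, hgU⟩ := exists_continuous_selection (Sum.elim a fun _ => -δ)
    (Sum.elim b fun _ => δ) (by rintro (i | i) <;> simp [hab, hδ.le]) L (Matrix.toLin' B) hUc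
    (by
      intro y hy
      have hz : y ∘ Sum.inr ∈ Metric.closedBall (0 : Fin n → ℝ) δ := by
        rw [mem_closedBall_zero_iff, pi_norm_le_iff_of_nonneg hδ.le]
        exact fun i => abs_le.2 ⟨hy.1 (Sum.inr i), hy.2 (Sum.inr i)⟩
      obtain ⟨u, hu, hBu⟩ := (hball hz).2 (-C.mulVec (y ∘ Sum.inl))
        ⟨_, ⟨_, fun i => ⟨hy.1 (Sum.inl i), hy.2 (Sum.inl i)⟩, rfl⟩, rfl⟩
      exact ⟨u, hu, by rw [hL, Matrix.toLin'_apply, ← hBu, sub_eq_add_neg]⟩)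
  refine ⟨δ, hδ, fun q => g (Sum.elim q.1 q.2), hg.comp ?_, fun w hw z hz => ?_⟩
  · refine continuous_pi fun i => ?_
    rcases i with i | i <;> simp only [Sum.elim_inl, Sum.elim_inr] <;> fun_prop
  · have hmem : Sum.elim w z ∈ Icc (Sum.elim a fun _ => -δ) (Sum.elim b fun _ => δ) := by
      have hzi := (pi_norm_le_iff_of_nonneg hδ.le).1 hz
      constructor <;> rintro (i | i)
      · exact (hw i).1
      · exact (abs_le.1 (hzi i)).1
      · exact (hw i).2
      · exact (abs_le.1 (hzi i)).2
    refine ⟨(hgU _ hmem).1, ?_⟩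
    have := (hgU _ hmem).2
    rw [hL, Matrix.toLin'_apply] at this
    rw [this]
    simp

end ResilientControl

theorem mainTheorem10 {n m p : ℕ}
    (A : Matrix (Fin n) (Fin n) ℝ) (B : Matrix (Fin n) (Fin m) ℝ) (C : Matrix (Fin n) (Fin p) ℝ)
    (U : Set (Fin m → ℝ)) (W : Set (Fin p → ℝ))
    (hU : ResilientControl.IsHyperrectangle U) (hW : ResilientControl.IsHyperrectangle W)
    (hZ : (0 : Fin n → ℝ) ∈ interior (ResilientControl.dualInputSet B C U W))
    (hA : ∀ μ ∈ ResilientControl.eigenvalueSet A, μ.re ≤ 0) :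
    ResilientControl.ResilientlyStabilizable A B C U W := by
  intro x₀ w hw
  obtain ⟨δ, hδ, g, hg, hgU⟩ := ResilientControl.exists_continuous_feedback hU hW hZ
  obtain ⟨T, hT, z, x, hz, hzn, hx, hx0, hxT⟩ :=
    ResilientControl.exists_solution_reaching_zero A hA x₀ hδ
  have hu : ResilientControl.PiecewiseContinuous fun t => g (w t, z t) :=
    hw.1.comp_continuous hz hg
  have hsol : ResilientControl.IsSolution A B C (fun t => g (w t, z t)) w x₀ x := by
    refine ⟨fun t _ => (hx t).continuousAt.continuousWithinAt, hx0, fun t ht _ _ => ?_⟩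
    rw [add_assoc, (hgU _ (hw.2 t ht.le) _ (hzn t)).2]
    exact hx t
  exact ⟨T, hT, _, ⟨hu, fun t ht => (hgU _ (hw.2 t ht) _ (hzn t)).1⟩, x, hsol,
    fun y hy => hy.eqOn hu hw.1 hsol, hxT⟩
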